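/- **Existence theorem.** The system of Kirchhoff equations of a planar circuit has a solution. In detail. A planar circuit is a finite connected (multi)graph drawn in the plane $\mathbb{C}$: the vertices (terminals) are distinct points, the edges are continuous lines joining their ends which have no self-crossings and meet each other and the terminals only at their ends. One edge $b$ is the battery; its two ends, the negative and the positive pole, are distinct, $b$ is directed from the negative pole to the positive one, and it carries a number $U\in\mathbb{R}$, the voltage. All other edges $e$ are resistors; each has an arbitrarily chosen direction and a resistance $R_e>0$. A part of the plane is a connected component of the complement of the drawing. The contour of a part $F$ is the closed walk in the graph that goes along the whole boundary of $F$ counterclockwise, i.e. with $F$ on its left, passing every edge at most once in each direction. Then there are real numbers $I_e$ (one for every edge $e$, the battery included), the currents, such that 1. (first Kirchhoff rule) for every terminal $v$, the sum of $I_e$ over the edges $e$ directed into $v$ equals the sum of $I_e$ over the edges $e$ directed out of $v$; 2. (second Kirchhoff rule) for the contour of every part of the plane, $\sum_{e\ne b}\pm R_eI_e=\sum_{b}\pm U$, where the left sum is over the passages of the contour through resistors, the right sum is over its passages through the battery (it is $0$ if there are none), and the sign is $+$ when the edge is passed in its chosen direction and $-$ otherwise. -/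

import Mathlib

open scoped unitInterval

/-- An electrical circuit whose underlying (multi)graph has vertices (terminals) `V` and edges `E`.
Every edge carries a chosen direction, from `tail e` to `head e`. One edge is the battery, directed
from the negative pole `tail battery` to the positive pole `head battery`; all the other edges are
resistors, with arbitrary chosen directions. Parallel resistors and resistors whose two ends
coincide are allowed. -/
structure Circuit (V E : Type*) where
  tail : E → V
  head : E → V
  battery : E
  poles_ne : tail battery ≠ head battery
  /-- The resistances; the value at the battery is irrelevant. -/
  resistance : E → ℝ
  resistance_pos : ∀ e, e ≠ battery → 0 < resistance e
  /-- The voltage of the battery; any real number is allowed. -/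
  voltage : ℝ

namespace Circuit

variable {V E : Type*}

/-- Walks in the graph of a circuit; an edge may be traversed along or against its direction. -/
inductive Walk (C : Circuit V E) : V → V → Type _
  | nil (v : V) : Walk C v v
  | forward (e : E) {v : V} (w : Walk C (C.head e) v) : Walk C (C.tail e) v
  | backward (e : E) {v : V} (w : Walk C (C.tail e) v) : Walk C (C.head e) v

/-- The circuit is connected: any two terminals are joined by a walk. -/
def Connected (C : Circuit V E) : Prop := ∀ u v : V, Nonempty (C.Walk u v)

namespace Walk

variable {C : Circuit V E}

/-- The list of traversed edges, each with `true` if it is traversed along its direction and with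
`false` if it is traversed against it. -/
def steps {u v : V} : C.Walk u v → List (E × Bool)
  | nil _ => []
  | forward e w => (e, true) :: w.steps
  | backward e w => (e, false) :: w.steps

/-- The algebraic sum of `f` along a walk: the value `f e` is taken with the sign `+` when `e` is
traversed along its direction and with the sign `-` when it is traversed against it. -/
def algebraicSum (f : E → ℝ) {u v : V} : C.Walk u v → ℝ
  | nil _ => 0
  | forward e w => f e + w.algebraicSum f
  | backward e w => -f e + w.algebraicSum f

end Walk

end Circuit

/-- The closed path `γ` in the plane makes `n` counterclockwise turns around the point `z` (and
does not meet `z`): a continuous logarithm of `γ - z` changes by `2πi * n`. -/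
def HasWindingNumber {a : ℂ} (γ : Path a a) (z : ℂ) (n : ℤ) : Prop :=
  ∃ f : C(I, ℂ), (∀ t, Complex.exp (f t) = γ t - z) ∧
    f 1 - f 0 = 2 * Real.pi * Complex.I * n

/-- A planar circuit: a connected circuit drawn in the plane `ℂ`. Terminals are distinct points,
every edge is a continuous line joining its two ends, and lines have no self-crossings, meet no
terminal other than at their ends, and do not meet each other other than at their ends. -/
structure PlanarCircuit (V E : Type*) extends Circuit V E where
  connected : toCircuit.Connected
  point : V → ℂ
  point_injective : Function.Injective point
  line : (e : E) → Path (point (tail e)) (point (head e))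
  line_injOn : ∀ e, Set.InjOn (line e) (Set.Ioo 0 1)
  line_ne_point : ∀ e, ∀ t ∈ Set.Ioo (0 : I) 1, ∀ v, line e t ≠ point v
  line_ne_line : ∀ e e', e ≠ e' →
    ∀ s ∈ Set.Ioo (0 : I) 1, ∀ t ∈ Set.Ioo (0 : I) 1, line e s ≠ line e' t

namespace PlanarCircuit

variable {V E : Type*} (C : PlanarCircuit V E)

/-- The set of all points of the plane that lie on the drawing. -/
def drawing : Set ℂ := Set.range C.point ∪ ⋃ e, Set.range (C.line e)

/-- `F` is one of the parts into which the circuit divides the plane (the unbounded part is one of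
them). -/
def IsFace (F : Set ℂ) : Prop :=
  ∃ z ∈ C.drawingᶜ, F = connectedComponentIn C.drawingᶜ z

/-- The path in the plane that runs along a walk. -/
noncomputable def curve {u v : V} : C.toCircuit.Walk u v → Path (C.point u) (C.point v)
  | .nil v => Path.refl (C.point v)
  | .forward e w => (C.line e).trans (curve w)
  | .backward e w => (C.line e).symm.trans (curve w)

/-- The closed walk `w` is the contour of the part `F`: it goes along the whole boundary of `F`,
passes at most once through every edge in each of the two directions, and goes around `F`
counterclockwise, with `F` on the left, i.e. its winding number around the points of `F` exceeds by
one its winding number around the points of all the other parts. (Around the points of the unbounded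
part a winding number is always zero, so for a bounded `F` the winding numbers are `1` inside `F`
and `0` in all the other parts; for the unbounded `F` they are `0` in `F` and `-1` in all the other
parts.) An edge both sides of which belong to `F` is passed in both directions. -/
def IsContour (F : Set ℂ) {v : V} (w : C.toCircuit.Walk v v) : Prop :=
  w.steps.Nodup ∧ Set.range (C.curve w) = frontier F ∧
    ∃ k : ℤ, (∀ z ∈ F, HasWindingNumber (C.curve w) z (k + 1)) ∧
      ∀ z ∈ C.drawingᶜ \ F, HasWindingNumber (C.curve w) z k

open Classical in
/-- First Kirchhoff rule: at every terminal the sum of the incoming currents equals the sum of the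
outgoing ones. The current `J e` is counted in the chosen direction of `e`. -/
def FirstRule [Fintype E] (J : E → ℝ) : Prop :=
  ∀ v : V, ∑ e with C.head e = v, J e = ∑ e with C.tail e = v, J e

open Classical in
/-- Second Kirchhoff rule: for the contour of any part of the plane, the algebraic sum of the
voltages `R e * J e` on its resistors equals the algebraic sum of the voltages on the batteries
that occur in it. -/
def SecondRule (J : E → ℝ) : Prop :=
  ∀ F : Set ℂ, C.IsFace F → ∀ (v : V) (w : C.toCircuit.Walk v v), C.IsContour F w →
    w.algebraicSum (fun e => if e = C.battery then 0 else C.resistance e * J e) =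
      w.algebraicSum (fun e => if e = C.battery then C.voltage else 0)

/-- The currents `J` (through the resistors and the battery) solve the system of Kirchhoff equations
of the circuit. -/
def IsKirchhoffSolution [Fintype E] (J : E → ℝ) : Prop := C.FirstRule J ∧ C.SecondRule J

end PlanarCircuit

/-! Planarity plays no role: the currents come from a potential `φ`, so the second rule holds along
every closed walk by telescoping. Dirichlet's principle supplies `φ`: among potentials with
increment `-U` at the battery, take one orthogonal, with weights `1/R`, to all variations fixing
that increment (`exists_weighted_orthogonal`). Ohm's law gives the resistor currents; the battery
current is the one remaining unknown, and it is fixed by testing against a single potential that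
does change along the battery. -/

namespace Circuit

variable {V E : Type*} (C : Circuit V E)

/-- The increments of a potential along the edges, as a linear map. -/
def increment : (V → ℝ) →ₗ[ℝ] (E → ℝ) where
  toFun φ e := φ (C.head e) - φ (C.tail e)
  map_add' φ ψ := by ext e; simp only [Pi.add_apply]; ring
  map_smul' c φ := by
    ext e; simp only [Pi.smul_apply, smul_eq_mul, RingHom.id_apply]; ring

theorem increment_apply (φ : V → ℝ) (e : E) :
    C.increment φ e = φ (C.head e) - φ (C.tail e) := rfl

namespace Walk

variable {C}

theorem algebraicSum_sub (f g : E → ℝ) {u v : V} (w : C.Walk u v) :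
    w.algebraicSum (f - g) = w.algebraicSum f - w.algebraicSum g := by
  induction w with
  | nil v => simp [algebraicSum]
  | forward e w ih => simp only [algebraicSum, ih, Pi.sub_apply]; ring
  | backward e w ih => simp only [algebraicSum, ih, Pi.sub_apply]; ring

theorem algebraicSum_increment (φ : V → ℝ) {u v : V} (w : C.Walk u v) :
    w.algebraicSum (C.increment φ) = φ v - φ u := by
  induction w with
  | nil v => simp [algebraicSum]
  | forward e w ih => simp only [algebraicSum, ih, increment_apply]; ring
  | backward e w ih => simp only [algebraicSum, ih, increment_apply]; ring

end Walk

/-- A potential whose increment at the battery is `1`. -/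
theorem exists_increment_battery_eq_one : ∃ χ : V → ℝ, C.increment χ C.battery = 1 := by
  classical
  exact ⟨Pi.single (C.head C.battery) 1, by simp [increment_apply, C.poles_ne]⟩

/-- Among the potentials whose increment at a given edge is prescribed there is one whose
increments are orthogonal, with respect to nonnegative weights `c`, to the increments of all the
potentials that do not change along that edge. -/
theorem exists_weighted_orthogonal [Fintype E] (c : E → ℝ) (hc : ∀ e, 0 ≤ c e) (φ₀ : V → ℝ)
    (b : E) :
    ∃ φ : V → ℝ, C.increment φ b = C.increment φ₀ b ∧
      ∀ ψ : V → ℝ, C.increment ψ b = 0 →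
        ∑ e, c e * C.increment φ e * C.increment ψ e = 0 := by
  -- Scaling by `√(c e)` turns the weighted form into the standard inner product. Weights may
  -- vanish, so the projection is made in the image of `T` and then lifted.
  let T : (V → ℝ) →ₗ[ℝ] EuclideanSpace ℝ E :=
    (WithLp.linearEquiv 2 ℝ (E → ℝ)).symm.toLinearMap ∘ₗ
      LinearMap.pi fun e => √(c e) • (LinearMap.proj e ∘ₗ C.increment)
  have hT : ∀ φ e, T φ e = √(c e) * C.increment φ e := fun φ e => rfl
  let S : Submodule ℝ (EuclideanSpace ℝ E) :=
    (LinearMap.ker (LinearMap.proj b ∘ₗ C.increment)).map T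
  obtain ⟨φ₁, hφ₁, hS⟩ := S.starProjection_apply_mem (T φ₀)
  have hφ₁b : C.increment φ₁ b = 0 := hφ₁
  refine ⟨φ₀ - φ₁, by simp [hφ₁b], fun ψ hψ => ?_⟩
  have h := (S.mem_orthogonal' _).1 (S.sub_starProjection_mem_orthogonal (T φ₀)) (T ψ)
    (Submodule.mem_map_of_mem hψ)
  rw [← hS, ← map_sub, PiLp.inner_apply] at h
  rw [← h]
  refine Finset.sum_congr rfl fun e _ => ?_
  simp only [hT, RCLike.inner_apply, conj_trivial]
  linear_combination -(C.increment (φ₀ - φ₁) e * C.increment ψ e) * Real.mul_self_sqrt (hc e)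

/-- Currents orthogonal to the increments of all potentials obey the conservation law at every
vertex. -/
theorem sum_head_eq_sum_tail [Fintype E] [DecidableEq V] {J : E → ℝ}
    (hJ : ∀ ψ : V → ℝ, ∑ e, J e * C.increment ψ e = 0) (v : V) :
    ∑ e with C.head e = v, J e = ∑ e with C.tail e = v, J e := by
  -- Test against the indicator of `v`; a loop at `v` counts on both sides.
  have h := hJ (Pi.single v 1)
  simp only [increment_apply, Pi.single_apply, mul_sub, mul_ite, mul_one, mul_zero,
    Finset.sum_sub_distrib] at h
  rw [Finset.sum_filter, Finset.sum_filter]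
  exact sub_eq_zero.1 h

/-- There are a potential and currents that obey Ohm's law on the resistors, with the voltage of
the battery prescribed, and the conservation law. -/
theorem exists_potential_current [Fintype E] :
    ∃ (φ : V → ℝ) (J : E → ℝ), C.increment φ C.battery = -C.voltage ∧
      (∀ e, e ≠ C.battery → C.resistance e * J e = C.increment φ e) ∧
      ∀ ψ : V → ℝ, ∑ e, J e * C.increment ψ e = 0 := by
  classical
  obtain ⟨χ, hχ⟩ := C.exists_increment_battery_eq_one
  -- Conductances; the battery obeys no Ohm's law, hence weight `0`.
  let c : E → ℝ := fun e => if e = C.battery then 0 else (C.resistance e)⁻¹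
  have hc : ∀ e, 0 ≤ c e := fun e => by
    by_cases he : e = C.battery
    · simp [c, he]
    · simpa [c, he] using (C.resistance_pos e he).le
  obtain ⟨φ, hφ, horth⟩ := C.exists_weighted_orthogonal c hc (-C.voltage • χ) C.battery
  let B : ℝ := ∑ e, c e * C.increment φ e * C.increment χ e
  refine ⟨φ, fun e => c e * C.increment φ e - if e = C.battery then B else 0, ?_, ?_, ?_⟩
  · simpa [hχ] using hφ
  · intro e he
    have := (C.resistance_pos e he).ne'
    simp only [c, he, if_false, sub_zero]
    field_simp
  · intro ψ
    -- Subtracting this multiple of `χ` makes `ψ` admissible in `horth`; the battery current `-B`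
    -- cancels the remaining term.
    have h := horth (ψ - C.increment ψ C.battery • χ) (by simp [hχ])
    simp only [map_sub, map_smul, Pi.sub_apply, Pi.smul_apply, smul_eq_mul, mul_sub,
      Finset.sum_sub_distrib, mul_left_comm _ (C.increment ψ C.battery), ← Finset.mul_sum] at h
    simp only [sub_mul, Finset.sum_sub_distrib, ite_mul, zero_mul, Finset.sum_ite_eq',
      Finset.mem_univ, if_true]
    linear_combination h

end Circuit

theorem mainTheorem6 {V E : Type*} [Finite V] [Fintype E] (C : PlanarCircuit V E) :
    ∃ J : E → ℝ, C.IsKirchhoffSolution J := by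
  classical
  obtain ⟨φ, J, hb, hJ, horth⟩ := C.toCircuit.exists_potential_current
  refine ⟨J, fun v => ?_, fun F _ v w _ => ?_⟩
  · convert C.toCircuit.sum_head_eq_sum_tail horth v
  · have h := w.algebraicSum_increment φ
    -- The difference of the two sides of the second rule is a potential increment, so it sums to
    -- zero along a closed walk.
    have hφ : C.increment φ =
        (fun e => if e = C.battery then 0 else C.resistance e * J e) -
          fun e => if e = C.battery then C.voltage else 0 := by
      ext e
      by_cases he : e = C.battery
      · simp [he, hb]
      · simp [he, hJ e he]
    rw [hφ, Circuit.Walk.algebraicSum_sub, sub_self, sub_eq_zero] at h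
    convert h
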